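/- Let $\mathcal{C}$ be an abelian category and $\mathcal{Q}$ a poset (viewed as a category). A functor $X\colon\mathcal{Q}\to\mathcal{C}$ is \emph{discretized} by a poset map $\alpha\colon\mathcal{D}\to\mathcal{Q}$ with $\mathcal{D}$ finite if $X$ is isomorphic to the left Kan extension along $\alpha$ of some functor $Y\colon\mathcal{D}\to\mathcal{C}$; $X$ is \emph{tame} if it is discretized by some such $\alpha$. Let $\mathrm{Tame}(\mathcal{Q},\mathcal{C})$ be the full subcategory of tame functors in $\mathrm{Fun}(\mathcal{Q},\mathcal{C})$. For a poset $\mathcal{D}$ let $\mathcal{D}_\ast=\mathcal{D}\cup\{-\infty\}$ be $\mathcal{D}$ with a new global minimum added. A poset map $\alpha\colon\mathcal{D}\to\mathcal{Q}$ \emph{admits a transfer} if the map $\alpha_\ast\colon\mathcal{D}_\ast\to\mathcal{Q}_\ast$ that extends $\alpha$ by $-\infty\mapsto-\infty$ has a right adjoint. The poset $\mathcal{Q}$ is of \emph{dimension at most $1$} if $w\le u\le x$ and $w\le v\le x$ in $\mathcal{Q}$ imply that $u$ and $v$ are comparable. An abelian category satisfies the \emph{minimal cover axiom} if for every object $X$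 there is an epimorphism $p\colon P\to X$ with $P$ projective such that every $\varphi\colon P\to P$ with $p\varphi=p$ is an isomorphism. The projective dimension in $\{0,1,2,\dots,\infty\}$ of an object is the smallest length of a projective resolution of it, where the length of $P_\bullet$ is the smallest $n\ge 0$ with $P_k=0$ for all $k>n$, or $\infty$ if there is no such $n$; the projective dimension $\text{proj-dim}$ of an abelian category with enough projectives is the supremum of the projective dimensions of its objects. Assume that every functor in $\mathrm{Tame}(\mathcal{Q},\mathcal{C})$ is discretized by a poset map (from a finite poset) that admits a transfer. Then: \begin{enumerate} \item The category $\mathrm{Tame}(\mathcal{Q},\mathcal{C})$ is abelian. \item If $\mathcal{C}$ has enough projectives, then so does $\mathrm{Tame}(\mathcal{Q},\mathcal{C})$. \item If $\mathcal{C}$ satisfies the minimal cover axiom, then so does $\mathrm{Tame}(\mathcal{Q},\mathcal{C})$. \item If $\mathcal{C}$ has enough projectives and $\mathcal{Q}$ is of dimension at most $1$, then \[\text{proj-dim}(\mathrm{Tame}(\mathcal{Q},\mathcal{C}))\le\text{proj-dim}(\mathcal{C})+1.\] \end{enumerate} -/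

import Mathlib

open CategoryTheory CategoryTheory.Limits

universe u v w

namespace TameFunctors

section Posets

/-- The poset map `α : D → Q` admits a transfer: the induced map `α_* : D ∪ {-∞} → Q ∪ {-∞}`
has a right adjoint (for posets, an adjunction is a Galois connection). -/
def AdmitsTransfer {D Q : Type*} [PartialOrder D] [PartialOrder Q] (α : D →o Q) : Prop :=
  ∃ r : WithBot Q →o WithBot D, GaloisConnection (WithBot.map α) r

/-- A poset has dimension at most `1` if any two elements of an interval `[a, b]` are
comparable. -/
def DimLEOne (Q : Type*) [PartialOrder Q] : Prop :=
  ∀ a x y b : Q, a ≤ x → x ≤ b → a ≤ y → y ≤ b → x ≤ y ∨ y ≤ x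

end Posets

section Tame

variable {Q : Type u} [PartialOrder Q] {C : Type w} [Category.{v} C]

/-- `X : Q ⥤ C` is discretized by the poset map `α : D → Q` if `X` is (together with a suitable
natural transformation) a left Kan extension along `α` of some functor `Y : D ⥤ C`. -/
def IsDiscretizedBy {D : Type*} [PartialOrder D] (X : Q ⥤ C) (α : D →o Q) : Prop :=
  ∃ (Y : D ⥤ C) (η : Y ⟶ α.monotone.functor ⋙ X), X.IsLeftKanExtension η

variable (Q C) in
/-- A functor `Q ⥤ C` is tame if it is discretized by a poset map from a finite poset. (Every
finite poset is isomorphic to one in the universe of `Q`.) -/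
def isTame : ObjectProperty (Q ⥤ C) := fun X =>
  ∃ (D : Type u) (_ : PartialOrder D) (α : D →o Q), Finite D ∧ IsDiscretizedBy X α

variable (Q C) in
/-- The category of tame functors, as a full subcategory of `Q ⥤ C`. -/
abbrev Tame : Type (max u v w) := (isTame Q C).FullSubcategory

variable (Q C) in
/-- Every tame functor `Q ⥤ C` is discretized by a poset map, from a finite poset, that admits a
transfer. -/
def TameDiscretizableByTransfers : Prop :=
  ∀ X : Q ⥤ C, isTame Q C X →
    ∃ (D : Type u) (_ : PartialOrder D) (α : D →o Q),
      Finite D ∧ AdmitsTransfer α ∧ IsDiscretizedBy X α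

end Tame

section Minimality

variable {C : Type w} [Category.{v} C]

/-- A morphism `f : X ⟶ Y` is minimal if every endomorphism of `X` over `Y` is an isomorphism. -/
def IsMinimalMorphism {X Y : C} (f : X ⟶ Y) : Prop :=
  ∀ φ : X ⟶ X, φ ≫ f = f → IsIso φ

variable (C) in
/-- The minimal cover axiom: every object is the target of a minimal epimorphism from a
projective object. -/
def MinimalCoverAxiom : Prop :=
  ∀ X : C, ∃ (P : C) (p : P ⟶ X), Projective P ∧ Epi p ∧ IsMinimalMorphism p

end Minimality

section ProjectiveDimension

variable {C : Type w} [Category.{v} C] [Abelian C]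

/-- The length of a projective resolution `P`: the smallest natural number `n` with `P_k = 0` for
all `k > n`, and `⊤` if there is none. -/
noncomputable def resolutionLength {X : C} (P : ProjectiveResolution X) : ℕ∞ :=
  sInf {n : ℕ∞ | ∀ k : ℕ, n < k → IsZero (P.complex.X k)}

/-- The projective dimension of an object: the smallest length of a projective resolution. -/
noncomputable def projDim (X : C) : ℕ∞ :=
  ⨅ P : ProjectiveResolution X, resolutionLength P

variable (C) in
/-- The projective dimension of an abelian category (with enough projectives): the supremum of the
projective dimensions of its objects. -/
noncomputable def catProjDim : ℕ∞ :=
  ⨆ X : C, projDim X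

end ProjectiveDimension

end TameFunctors

/-!
If `α` admits a transfer, a left Kan extension along `α` vanishes at the elements of `Q` that are
not above the image of `α`, and at any other `q` it is the value at the greatest element of the
image below `q`. So under the assumption every tame functor is constructible with respect to a
finite set `S` such that every element of `Q` above `S` has such a floor in `S`, and
constructibility with respect to a fixed `S` passes to limits, colimits and retracts. Two tame
functors are constructible with respect to a common `S`, because their coproduct is tame.

Projective covers of a constructible functor `X` are free functors on the elements of `S`. Over the
finite poset `S` a form of Nakayama's lemma holds: a morphism to `X` is an epimorphism as soon as it
is one on the quotients of the `X s` by the images of the `X t` with `t < s`. Minimal covers of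
these quotients therefore lift to a minimal cover of `X`. If `Q` has dimension at most one, the free
functor on the values `X s` maps onto `X`, and the relations among its generators are free on the
covering pairs of `S`. This short exact sequence adds at most one to the projective dimension.
-/

namespace TameFunctors

section KanExtensions

lemma nonempty_isColimit_iff_isIso_ι_app {J C : Type*} [Category* J] [Category* C] {F : J ⥤ C}
    (c : Cocone F) {j : J} (hj : IsTerminal j) : Nonempty (IsColimit c) ↔ IsIso (c.ι.app j) :=
  ⟨fun ⟨hc⟩ => hc.isIso_ι_app_of_isTerminal j hj,
    fun h => ⟨(colimitOfDiagramTerminal hj F).ofPointIso (i := h)⟩⟩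

variable {D Q : Type*} [PartialOrder D] [PartialOrder Q] {C : Type w} [Category.{v} C]
  {α : D →o Q}

lemma nonempty_isTerminal_costructuredArrow {q : Q} {d : D} (hd : ∀ e, α e ≤ q ↔ e ≤ d) :
    Nonempty (IsTerminal
      (CostructuredArrow.mk (S := α.monotone.functor) (homOfLE ((hd d).2 le_rfl)))) :=
  ⟨IsTerminal.ofUniqueHom
    (fun E => CostructuredArrow.homMk (homOfLE ((hd E.left).1 (leOfHom E.hom)))
      (Subsingleton.elim _ _))
    fun _ _ => CostructuredArrow.hom_ext _ _ (Subsingleton.elim _ _)⟩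

lemma isEmpty_costructuredArrow {q : Q} (hq : ∀ e, ¬ α e ≤ q) :
    IsEmpty (CostructuredArrow α.monotone.functor q) :=
  ⟨fun E => hq E.left (leOfHom E.hom)⟩

variable {X : Q ⥤ C} {Y : D ⥤ C}

lemma hasPointwiseLeftKanExtension_of_exists [HasInitial C]
    (h : ∀ q, (∃ d, ∀ e, α e ≤ q ↔ e ≤ d) ∨ ∀ e, ¬ α e ≤ q) :
    α.monotone.functor.HasPointwiseLeftKanExtension Y := by
  intro q
  obtain ⟨d, hd⟩ | hq := h q
  · have := (nonempty_isTerminal_costructuredArrow hd).some.hasTerminal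
    exact hasColimit_of_domain_hasTerminal
  · have := isEmpty_costructuredArrow hq
    have := hasColimitsOfShape_of_equivalence (C := C)
      (equivalenceOfIsEmpty (Discrete PEmpty.{1}) (CostructuredArrow α.monotone.functor q))
    infer_instance

theorem isLeftKanExtension_iff_of_exists [HasInitial C]
    (h : ∀ q, (∃ d, ∀ e, α e ≤ q ↔ e ≤ d) ∨ ∀ e, ¬ α e ≤ q) (η : Y ⟶ α.monotone.functor ⋙ X) :
    X.IsLeftKanExtension η ↔
      (∀ q d (hd : ∀ e, α e ≤ q ↔ e ≤ d), IsIso (η.app d ≫ X.map (homOfLE ((hd d).2 le_rfl)))) ∧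
        ∀ q, (∀ e, ¬ α e ≤ q) → Nonempty (IsInitial (X.obj q)) := by
  let E := Functor.LeftExtension.mk X η
  have isIso_iff {q d} (hd : ∀ e, α e ≤ q ↔ e ≤ d) :
      Nonempty (E.IsPointwiseLeftKanExtensionAt q) ↔
        IsIso (η.app d ≫ X.map (homOfLE ((hd d).2 le_rfl))) :=
    nonempty_isColimit_iff_isIso_ι_app _ (nonempty_isTerminal_costructuredArrow hd).some
  have isInitial_iff {q} (hq : ∀ e, ¬ α e ≤ q) :
      Nonempty (E.IsPointwiseLeftKanExtensionAt q) ↔ Nonempty (IsInitial (X.obj q)) :=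
    have := isEmpty_costructuredArrow hq
    (isColimitEquivIsInitialOfIsEmpty C (E.coconeAt q)).nonempty_congr
  constructor
  · intro
    have := hasPointwiseLeftKanExtension_of_exists h (Y := Y)
    have hE := Functor.isPointwiseLeftKanExtensionOfIsLeftKanExtension X η
    exact ⟨fun q d hd => (isIso_iff hd).1 ⟨hE q⟩, fun q hq => (isInitial_iff hq).1 ⟨hE q⟩⟩
  · rintro ⟨hiso, hinit⟩
    have hE (q) : Nonempty (E.IsPointwiseLeftKanExtensionAt q) := by
      obtain ⟨d, hd⟩ | hq := h q
      exacts [(isIso_iff hd).2 (hiso q d hd), (isInitial_iff hq).2 (hinit q hq)]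
    exact Functor.LeftExtension.IsPointwiseLeftKanExtension.isLeftKanExtension fun q => (hE q).some

end KanExtensions

section Discretized

variable {D E Q : Type u} [PartialOrder D] [PartialOrder E] [PartialOrder Q]
  {C : Type w} [Category.{v} C] {X X' : Q ⥤ C}

lemma hasPointwiseLeftKanExtension_of_finite [Finite D] [HasFiniteColimits C] (α : D →o Q)
    (Y : D ⥤ C) : α.monotone.functor.HasPointwiseLeftKanExtension Y := fun q => by
  have hinj : Function.Injective (fun E : CostructuredArrow α.monotone.functor q => E.left) := by
    rintro ⟨d, ⟨⟨⟩⟩, f⟩ ⟨_, ⟨⟨⟩⟩, g⟩ rfl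
    obtain rfl := Subsingleton.elim f g
    rfl
  have := Fintype.ofFinite D
  have := Fintype.ofInjective _ hinj
  have : Quiver.IsThin (CostructuredArrow α.monotone.functor q) := fun _ _ =>
    ⟨fun _ _ => CostructuredArrow.hom_ext _ _ (Subsingleton.elim _ _)⟩
  infer_instance

lemma IsDiscretizedBy.of_comp [Finite D] [HasFiniteColimits C] {γ : D →o E} {β : E →o Q}
    (hX : IsDiscretizedBy X (β.comp γ)) : IsDiscretizedBy X β := by
  obtain ⟨Y, η, hη⟩ := hX
  have := hasPointwiseLeftKanExtension_of_finite γ Y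
  let F := γ.monotone.functor
  let G := β.monotone.functor
  let δ : F.leftKanExtension Y ⟶ G ⋙ X :=
    (F.leftKanExtension Y).descOfIsLeftKanExtension (F.leftKanExtensionUnit Y) (G ⋙ X) η
  refine ⟨_, δ, (Functor.isLeftKanExtension_iff_postcompose (F.leftKanExtensionUnit Y)
    (F ⋙ G) (Iso.refl _) δ η ?_).2 hη⟩
  ext d
  simpa [δ] using Functor.descOfIsLeftKanExtension_fac_app _ (F.leftKanExtensionUnit Y) (G ⋙ X) η d

lemma isDiscretizedBy_iff_essImage_lan {α : D →o Q}
    [∀ Y : D ⥤ C, α.monotone.functor.HasLeftKanExtension Y] :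
    IsDiscretizedBy X α ↔ α.monotone.functor.lan.essImage X := by
  constructor
  · rintro ⟨Y, η, hη⟩
    exact ⟨Y, ⟨Functor.leftKanExtensionUnique _ (α.monotone.functor.lanUnit.app Y) X η⟩⟩
  · rintro ⟨Y, ⟨e⟩⟩
    exact ⟨Y, _, Functor.isLeftKanExtension_of_iso e (α.monotone.functor.lanUnit.app Y) _ rfl⟩

lemma IsDiscretizedBy.coprod [Finite D] [HasFiniteColimits C] {α : D →o Q}
    (hX : IsDiscretizedBy X α) (hX' : IsDiscretizedBy X' α) : IsDiscretizedBy (X ⨿ X') α := by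
  have := hasPointwiseLeftKanExtension_of_finite (C := C) α
  let F : (D ⥤ C) ⥤ Q ⥤ C := α.monotone.functor.lan
  rw [isDiscretizedBy_iff_essImage_lan] at hX hX' ⊢
  obtain ⟨Y, ⟨e⟩⟩ := hX
  obtain ⟨Y', ⟨e'⟩⟩ := hX'
  have : PreservesColimitsOfShape (Discrete WalkingPair) F :=
    (α.monotone.functor.lanAdjunction C).leftAdjoint_preservesColimits.preservesColimitsOfShape
  exact ⟨Y ⨿ Y', ⟨(PreservesColimitPair.iso F Y Y').symm ≪≫ coprod.mapIso e e'⟩⟩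

end Discretized

section Constructible

variable {Q : Type u} [PartialOrder Q] {C : Type w} [Category.{v} C] {S : Set Q} {X : Q ⥤ C}

/-- Every element of `Q` above some element of `S` is above a greatest one. -/
def HasFloors (S : Set Q) : Prop :=
  ∀ q, (S ∩ Set.Iic q).Nonempty → ∃ t, IsGreatest (S ∩ Set.Iic q) t

/-- A functor is constructible with respect to `S` if it vanishes on elements not above any
element of `S`, and its value at any other `q` is its value at the greatest element of `S`
below `q`. -/
structure IsConstructible (S : Set Q) (X : Q ⥤ C) : Prop where
  isZero : ∀ q, (∀ s ∈ S, ¬ s ≤ q) → IsZero (X.obj q)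
  isIso : ∀ s q (h : s ≤ q), IsGreatest (S ∩ Set.Iic q) s → IsIso (X.map (homOfLE h))

lemma HasFloors.exists_le_iff (hS : HasFloors S) (q : Q) :
    (∃ t : S, ∀ s : S, (s : Q) ≤ q ↔ s ≤ t) ∨ ∀ s : S, ¬ (s : Q) ≤ q := by
  refine or_iff_not_imp_right.2 fun h => ?_
  push Not at h
  obtain ⟨s, hsq⟩ := h
  obtain ⟨t, ⟨htS, htq⟩, ht⟩ := hS q ⟨s, s.2, hsq⟩
  exact ⟨⟨t, htS⟩, fun r => ⟨fun h => ht ⟨r.2, h⟩, fun h => le_trans h htq⟩⟩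

lemma IsConstructible.isDiscretizedBy [HasZeroObject C] (hS : HasFloors S)
    (hX : IsConstructible S X) : IsDiscretizedBy X (OrderHom.Subtype.val (· ∈ S)) := by
  refine ⟨_, 𝟙 _, (isLeftKanExtension_iff_of_exists hS.exists_le_iff _).2
    ⟨fun q t ht => ?_, fun q hq => ⟨(hX.isZero q fun s hs => hq ⟨s, hs⟩).isInitial⟩⟩⟩
  have := hX.isIso t q ((ht t).2 le_rfl)
    ⟨⟨t.2, (ht t).2 le_rfl⟩, fun s hs => (ht ⟨s, hs.1⟩).1 hs.2⟩
  exact IsIso.comp_isIso' (IsIso.id _) this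

lemma IsConstructible.isTame [HasZeroObject C] (hfin : S.Finite)
    (hS : HasFloors S) (hX : IsConstructible S X) : isTame Q C X :=
  ⟨S, inferInstance, OrderHom.Subtype.val (· ∈ S), hfin.to_subtype, hX.isDiscretizedBy hS⟩

section Transfer

variable {D : Type*} [PartialOrder D] {α : D →o Q}

lemma AdmitsTransfer.exists_map_le_iff (hα : AdmitsTransfer α) (q : Q) :
    (∃ d, ∀ e, α e ≤ q ↔ e ≤ d) ∨ ∀ e, ¬ α e ≤ q := by
  obtain ⟨r, hr⟩ := hα
  have h (e : D) : α e ≤ q ↔ (e : WithBot D) ≤ r q := by simpa using hr e q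
  cases hq : r q with
  | bot => exact Or.inr fun e => by simp [h, hq]
  | coe d => exact Or.inl ⟨d, fun e => by simp [h, hq]⟩

lemma AdmitsTransfer.hasFloors (hα : AdmitsTransfer α) : HasFloors (Set.range α) := by
  rintro q ⟨_, ⟨e, rfl⟩, he⟩
  obtain ⟨d, hd⟩ | hq := hα.exists_map_le_iff q
  · refine ⟨α d, ⟨⟨d, rfl⟩, (hd d).2 le_rfl⟩, ?_⟩
    rintro _ ⟨⟨e', rfl⟩, he'⟩
    exact α.monotone ((hd e').1 he')
  · exact absurd he (hq e)

lemma AdmitsTransfer.isConstructible [HasZeroObject C] (hα : AdmitsTransfer α)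
    (hX : IsDiscretizedBy X α) : IsConstructible (Set.range α) X := by
  obtain ⟨Y, η, hη⟩ := hX
  obtain ⟨hiso, hinit⟩ := (isLeftKanExtension_iff_of_exists hα.exists_map_le_iff η).1 hη
  refine ⟨fun q hq => (isZero_zero C).of_iso
    ((hinit q fun e => hq _ ⟨e, rfl⟩).some.uniqueUpToIso HasZeroObject.zeroIsInitial), ?_⟩
  rintro s q hsq hs
  obtain ⟨e, he⟩ := hs.1.1
  obtain ⟨d, hd⟩ | h := hα.exists_map_le_iff q
  · obtain rfl : s = α d :=
      le_antisymm (he ▸ α.monotone ((hd e).1 (he.trans_le hsq)))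
        (hs.2 ⟨⟨d, rfl⟩, (hd d).2 le_rfl⟩)
    let f : Y.obj d ⟶ X.obj (α d) := η.app d
    have h₁ : IsIso (f ≫ X.map (homOfLE le_rfl)) :=
      hiso (α d) d fun e => ⟨fun h => (hd e).1 (h.trans hsq), fun h => α.monotone h⟩
    have h₂ : IsIso (f ≫ X.map (homOfLE hsq)) := hiso q d hd
    have : IsIso f := by simpa using h₁
    exact IsIso.of_isIso_comp_left f _
  · exact absurd (he.trans_le hsq) (h e)

end Transfer

end Constructible

section Limits

lemma isIso_app_conePt_of_preservesLimit {A B J : Type*} [Category* A] [Category* B] [Category* J]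
    (K : J ⥤ A) {F G : A ⥤ B} (τ : F ⟶ G) [IsIso (Functor.whiskerLeft K τ)] (c : Cone K)
    (hc : IsLimit c) [PreservesLimit K F] [PreservesLimit K G] : IsIso (τ.app c.pt) := by
  let e := IsLimit.conePointsIsoOfNatIso (isLimitOfPreserves F hc) (isLimitOfPreserves G hc)
    (asIso (Functor.whiskerLeft K τ))
  have he : e.hom = τ.app c.pt := (isLimitOfPreserves G hc).hom_ext fun j =>
    (IsLimit.conePointsIsoOfNatIso_hom_comp _ _ _ _).trans (τ.naturality (c.π.app j))
  exact he ▸ inferInstance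

namespace IsConstructible

variable {Q : Type u} [PartialOrder Q] {C : Type w} [Category.{v} C] [HasZeroMorphisms C]
  {S : Set Q} {X Y : Q ⥤ C} {J : Type*} [Category* J] {K : J ⥤ Q ⥤ C}

lemma of_retract (r : Retract X Y) (hY : IsConstructible S Y) : IsConstructible S X where
  isZero q hq := (hY.isZero q hq).of_mono (r.map ((evaluation Q C).obj q)).i
  isIso s q hsq hs := MorphismProperty.of_retract (P := .isomorphisms C)
    (NatTrans.retractArrowApp ((evaluation Q C).map (homOfLE hsq)) r) (hY.isIso s q hsq hs)

lemma of_isLimit [HasZeroObject C] [HasLimitsOfShape J C] {c : Cone K} (hc : IsLimit c)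
    (h : ∀ j, IsConstructible S (K.obj j)) : IsConstructible S c.pt where
  isZero q hq := (isLimitOfPreserves ((evaluation Q C).obj q) hc).isZero_pt
    (Functor.isZero _ fun j => (h j).isZero q hq)
  isIso s q hsq hs := by
    let τ := (evaluation Q C).map (homOfLE hsq)
    have : ∀ j, IsIso ((Functor.whiskerLeft K τ).app j) := fun j => (h j).isIso s q hsq hs
    have := NatIso.isIso_of_isIso_app (Functor.whiskerLeft K τ)
    exact isIso_app_conePt_of_preservesLimit K τ c hc

lemma of_isColimit [HasZeroObject C] [HasColimitsOfShape J C] {c : Cocone K} (hc : IsColimit c)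
    (h : ∀ j, IsConstructible S (K.obj j)) : IsConstructible S c.pt where
  isZero q hq := (isColimitOfPreserves ((evaluation Q C).obj q) hc).isZero_pt
    (Functor.isZero _ fun j => (h j).isZero q hq)
  isIso s q hsq hs := by
    let τ := (evaluation Q C).map (homOfLE hsq)
    have : ∀ j, IsIso ((Functor.whiskerLeft K τ).app j) := fun j => (h j).isIso s q hsq hs
    have := NatIso.isIso_of_isIso_app (Functor.whiskerLeft K τ)
    exact isIso_app_coconePt_of_preservesColimit K τ c hc

end IsConstructible

end Limits

section Closure

variable {Q : Type u} [PartialOrder Q] {C : Type w} [Category.{v} C] {X Y : Q ⥤ C}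

lemma IsDiscretizedBy.of_range_subset [HasFiniteColimits C] {D : Type u} [PartialOrder D]
    [Finite D] {α : D →o Q} (hX : IsDiscretizedBy X α) {S : Set Q} (h : Set.range α ⊆ S) :
    IsDiscretizedBy X (OrderHom.Subtype.val (· ∈ S)) :=
  let γ : D →o S := ⟨fun d => ⟨α d, h ⟨d, rfl⟩⟩, fun _ _ hde => α.monotone hde⟩
  IsDiscretizedBy.of_comp (γ := γ) (β := OrderHom.Subtype.val (· ∈ S)) hX

variable (Q C) in
lemma isClosedUnderIsomorphisms_isTame : (isTame Q C).IsClosedUnderIsomorphisms where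
  of_iso := by
    rintro X Y e ⟨D, _, α, hD, Z, η, hη⟩
    exact ⟨D, _, α, hD, Z, _, Functor.isLeftKanExtension_of_iso e η _ rfl⟩

lemma isTame_coprod [HasFiniteColimits C] (hX : isTame Q C X) (hY : isTame Q C Y) :
    isTame Q C (X ⨿ Y) := by
  obtain ⟨D, _, α, _, hX⟩ := hX
  obtain ⟨E, _, β, _, hY⟩ := hY
  let S := Set.range α ∪ Set.range β
  exact ⟨S, inferInstance, OrderHom.Subtype.val (· ∈ S),
    ((Set.finite_range α).union (Set.finite_range β)).to_subtype,
    (hX.of_range_subset Set.subset_union_left).coprod (hY.of_range_subset Set.subset_union_right)⟩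

lemma exists_isConstructible [HasZeroObject C] (hQ : TameDiscretizableByTransfers Q C)
    (hX : isTame Q C X) : ∃ S : Set Q, S.Finite ∧ HasFloors S ∧ IsConstructible S X := by
  obtain ⟨D, _, α, _, hα, h⟩ := hQ X hX
  exact ⟨Set.range α, Set.finite_range α, hα.hasFloors, hα.isConstructible h⟩

variable [Abelian C]

-- The union of two sets with floors need not have floors, so `X` and `Y` have to be treated
-- together: as retracts of their coproduct.
lemma exists_isConstructible_pair (hQ : TameDiscretizableByTransfers Q C)
    (hX : isTame Q C X) (hY : isTame Q C Y) :
    ∃ S : Set Q, S.Finite ∧ HasFloors S ∧ IsConstructible S X ∧ IsConstructible S Y := by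
  obtain ⟨S, hfin, hS, h⟩ := exists_isConstructible hQ (isTame_coprod hX hY)
  exact ⟨S, hfin, hS, h.of_retract ⟨coprod.inl, coprod.desc (𝟙 X) 0, coprod.inl_desc _ _⟩,
    h.of_retract ⟨coprod.inr, coprod.desc 0 (𝟙 Y), coprod.inr_desc _ _⟩⟩

open ZeroObject in
variable (Q C) in
lemma containsZero_isTame : (isTame Q C).ContainsZero where
  exists_zero := by
    have h : IsZero (0 : Q ⥤ C) := isZero_zero _
    exact ⟨_, h, IsConstructible.isTame Set.finite_empty (fun _ ⟨_, hs⟩ => hs.1.elim)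
      ⟨fun _ _ => h.obj _, fun _ _ _ hs => hs.1.1.elim⟩⟩

lemma isClosedUnderKernels_isTame (hQ : TameDiscretizableByTransfers Q C) :
    (isTame Q C).IsClosedUnderKernels where
  kernels_le := by
    rintro _ ⟨f, k, hk, hX, hY⟩
    obtain ⟨S, hfin, hS, hX, hY⟩ := exists_isConstructible_pair hQ hX hY
    exact (IsConstructible.of_isLimit hk (by rintro (_ | _); exacts [hX, hY])).isTame hfin hS

lemma isClosedUnderCokernels_isTame (hQ : TameDiscretizableByTransfers Q C) :
    (isTame Q C).IsClosedUnderCokernels where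
  cokernels_le := by
    rintro _ ⟨f, k, hk, hX, hY⟩
    obtain ⟨S, hfin, hS, hX, hY⟩ := exists_isConstructible_pair hQ hX hY
    exact (IsConstructible.of_isColimit hk (by rintro (_ | _); exacts [hX, hY])).isTame hfin hS

lemma isClosedUnderFiniteProducts_isTame (hQ : TameDiscretizableByTransfers Q C) :
    (isTame Q C).IsClosedUnderFiniteProducts := by
  have := containsZero_isTame Q C
  have := isClosedUnderIsomorphisms_isTame Q C
  have : (isTame Q C).IsClosedUnderBinaryProducts :=
    { limitsOfShape_le := by
        rintro X ⟨p⟩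
        obtain ⟨S, hfin, hS, hleft, hright⟩ := exists_isConstructible_pair hQ
          (p.prop_diag_obj (.mk .left)) (p.prop_diag_obj (.mk .right))
        exact (IsConstructible.of_isLimit p.isLimit
          (by rintro ⟨_ | _⟩; exacts [hleft, hright])).isTame hfin hS }
  exact .mk'

end Closure

section Free

variable {Q : Type u} [PartialOrder Q] {C : Type w} [Category.{v} C] [HasFiniteCoproducts C]
  {I : Type*} [Finite I]

/-- The free functor on objects `A i` placed at the elements `t i` of `Q`: it corepresents the
families of morphisms `A i ⟶ X.obj (t i)`. -/
noncomputable def free (t : I → Q) (A : I → C) : Q ⥤ C where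
  obj q := ∐ fun p : {i // t i ≤ q} => A p
  map {q q'} f := Sigma.desc fun p =>
    Sigma.ι (fun p : {i // t i ≤ q'} => A p) ⟨p, p.2.trans f.le⟩

namespace free

variable {t : I → Q} {A B : I → C} {X : Q ⥤ C} {q q' : Q} {Z : C}

variable (t A) in
/-- The generator `A i` of a free functor, inside the value at some `q ≥ t i`. -/
noncomputable def incl (i : I) (h : t i ≤ q) : A i ⟶ (free t A).obj q :=
  Sigma.ι (fun p : {i // t i ≤ q} => A p) ⟨i, h⟩

lemma incl_map (i : I) (h : t i ≤ q) (f : q ⟶ q') :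
    incl t A i h ≫ (free t A).map f = incl t A i (h.trans f.le) :=
  Sigma.ι_desc _ _

lemma obj_hom_ext {f g : (free t A).obj q ⟶ Z}
    (h : ∀ i (hi : t i ≤ q), incl t A i hi ≫ f = incl t A i hi ≫ g) : f = g :=
  Sigma.hom_ext _ _ fun p => h p p.2

/-- The morphism out of a value of a free functor with given restrictions to the generators. -/
noncomputable def objDesc (f : ∀ i, t i ≤ q → (A i ⟶ Z)) : (free t A).obj q ⟶ Z :=
  Sigma.desc fun p => f p p.2

lemma incl_objDesc (f : ∀ i, t i ≤ q → (A i ⟶ Z)) (i : I) (h : t i ≤ q) :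
    incl t A i h ≫ objDesc f = f i h :=
  Sigma.ι_desc _ _

lemma isZero_obj [HasZeroMorphisms C] (h : ∀ i, ¬ t i ≤ q) : IsZero ((free t A).obj q) :=
  (IsZero.iff_id_eq_zero _).2 (obj_hom_ext fun i hi => absurd hi (h i))

/-- The morphism out of a free functor with given restrictions to the generators. -/
noncomputable def desc (φ : ∀ i, A i ⟶ X.obj (t i)) : free t A ⟶ X where
  app q := objDesc fun i h => φ i ≫ X.map (homOfLE h)
  naturality q q' f := obj_hom_ext fun i h => by
    rw [reassoc_of% incl_map, incl_objDesc, reassoc_of% incl_objDesc, Category.assoc,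
      ← X.map_comp]
    rfl

lemma incl_desc_app (φ : ∀ i, A i ⟶ X.obj (t i)) (i : I) (h : t i ≤ q) :
    incl t A i h ≫ (desc φ).app q = φ i ≫ X.map (homOfLE h) :=
  incl_objDesc (fun i h => φ i ≫ X.map (homOfLE h)) i h

lemma incl_desc_app_self (φ : ∀ i, A i ⟶ X.obj (t i)) (i : I) :
    incl t A i le_rfl ≫ (desc φ).app (t i) = φ i := by
  simp [incl_desc_app]

lemma hom_ext {f g : free t A ⟶ X}
    (h : ∀ i, incl t A i le_rfl ≫ f.app (t i) = incl t A i le_rfl ≫ g.app (t i)) : f = g := by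
  ext q
  refine obj_hom_ext fun i hi => ?_
  have hincl : incl t A i hi = incl t A i le_rfl ≫ (free t A).map (homOfLE hi) :=
    (incl_map i le_rfl _).symm
  simp only [hincl, Category.assoc, NatTrans.naturality, reassoc_of% h i]

lemma projective [HasPushouts C] [∀ i, Projective (A i)] : Projective (free t A) where
  factors {E X} f e he := by
    refine ⟨desc fun i => Projective.factorThru (incl t A i le_rfl ≫ f.app (t i)) (e.app (t i)),
      hom_ext fun i => ?_⟩
    rw [NatTrans.comp_app, reassoc_of% incl_desc_app_self, Projective.factorThru_comp]

lemma isConstructible [HasZeroMorphisms C] {S : Set Q} (ht : ∀ i, t i ∈ S) :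
    IsConstructible S (free t A) where
  isZero q hq := isZero_obj fun i => hq _ (ht i)
  isIso s q h hs := by
    refine ⟨objDesc fun i hi => incl t A i (hs.2 ⟨ht i, hi⟩), ?_, ?_⟩
    · refine obj_hom_ext fun i hi => ?_
      rw [reassoc_of% incl_map, incl_objDesc, Category.comp_id]
    · refine obj_hom_ext fun i hi => ?_
      rw [reassoc_of% incl_objDesc, incl_map, Category.comp_id]

/-- Functoriality of free functors in the family of generators. -/
noncomputable def map (a : ∀ i, A i ⟶ B i) : free t A ⟶ free t B :=
  desc fun i => a i ≫ incl t B i le_rfl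

lemma incl_map_app (a : ∀ i, A i ⟶ B i) (i : I) (h : t i ≤ q) :
    incl t A i h ≫ (map a).app q = a i ≫ incl t B i h := by
  rw [map, incl_desc_app, Category.assoc, incl_map]

lemma map_app (a : ∀ i, A i ⟶ B i) :
    (map a).app q = Limits.Sigma.map fun p : {i // t i ≤ q} => a p :=
  obj_hom_ext fun i h =>
    (incl_map_app a i h).trans (Sigma.ι_map (fun p : {i // t i ≤ q} => a p) ⟨i, h⟩).symm

variable (t) in
/-- The short complex of free functors on a family of short complexes. -/
noncomputable abbrev shortComplex [HasZeroMorphisms C] (S : I → ShortComplex C) :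
    ShortComplex (Q ⥤ C) :=
  .mk (map fun i => (S i).f : free t _ ⟶ _) (map fun i => (S i).g) <| by
    ext q
    refine obj_hom_ext fun i h => ?_
    rw [NatTrans.comp_app, reassoc_of% incl_map_app, incl_map_app, (S i).zero_assoc, zero_comp,
      zero_app, comp_zero]

end free

end Free

section ShortExact

variable {C : Type w} [Category.{v} C] [Abelian C] {J : Type*}

lemma shortExact_of_evaluation [Category* J] {S : ShortComplex (J ⥤ C)}
    (h : ∀ j, (S.map ((evaluation J C).obj j)).ShortExact) : S.ShortExact where
  exact := (ShortComplex.exact_iff_isZero_homology S).2 <| Functor.isZero _ fun j =>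
    ((ShortComplex.exact_iff_isZero_homology _).1 (h j).exact).of_iso
      (S.mapHomologyIso ((evaluation J C).obj j)).symm
  mono_f :=
    have (j : J) : Mono (S.f.app j) := (h j).mono_f
    NatTrans.mono_of_mono_app _
  epi_g :=
    have (j : J) : Epi (S.g.app j) := (h j).epi_g
    NatTrans.epi_of_epi_app _

lemma shortExact_sigmaMap [Finite J] {S : J → ShortComplex C} (h : ∀ j, (S j).ShortExact) :
    (ShortComplex.mk (Limits.Sigma.map fun j => (S j).f) (Limits.Sigma.map fun j => (S j).g)
      (Sigma.hom_ext _ _ fun j => by simp)).ShortExact := by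
  let T : ShortComplex (Discrete J ⥤ C) :=
    .mk (X₁ := Discrete.functor fun j => (S j).X₁) (X₂ := Discrete.functor fun j => (S j).X₂)
      (X₃ := Discrete.functor fun j => (S j).X₃) (Discrete.natTrans fun j => (S j.as).f)
      (Discrete.natTrans fun j => (S j.as).g) (by ext j; exact (S j.as).zero)
  have hT : T.ShortExact := shortExact_of_evaluation fun j => h j.as
  have := Abelian.hasFiniteBiproducts (C := C)
  have : PreservesFiniteLimits (colim (J := Discrete J) (C := C)) :=
    HasExactColimitsOfShape.preservesFiniteLimits
  exact hT.map_of_exact colim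

lemma shortExact_kernel_projectiveπ [EnoughProjectives C] (X : C) :
    (ShortComplex.mk (kernel.ι (Projective.π X)) (Projective.π X)
      (kernel.condition _)).ShortExact where
  exact := ShortComplex.exact_kernel _
  mono_f := inferInstanceAs (Mono (kernel.ι _))
  epi_g := inferInstanceAs (Epi (Projective.π X))

lemma free.shortExact {Q : Type u} [PartialOrder Q] {I : Type*} [Finite I] (t : I → Q)
    {S : I → ShortComplex C} (h : ∀ i, (S i).ShortExact) :
    (free.shortComplex t S).ShortExact := by
  refine shortExact_of_evaluation fun q => ?_
  have hsum := shortExact_sigmaMap (S := fun p : {i // t i ≤ q} => S p) fun p => h p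
  refine ShortComplex.shortExact_of_iso ?_ hsum
  refine ShortComplex.isoMk (Iso.refl _) (Iso.refl _) (Iso.refl _) ?_ ?_
  · exact (Category.id_comp _).trans ((free.map_app fun i => (S i).f).trans
      (Category.comp_id _).symm)
  · exact (Category.id_comp _).trans ((free.map_app fun i => (S i).g).trans
      (Category.comp_id _).symm)

end ShortExact

section TopPart

variable {Q : Type u} [PartialOrder Q] {C : Type w} [Category.{v} C] {S : Set Q} {X Z : Q ⥤ C}

lemma IsConstructible.hom_ext (hX : IsConstructible S X) (hS : HasFloors S) {q : Q} {A : C}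
    {f g : X.obj q ⟶ A}
    (h : ∀ s ∈ S, ∀ hs : s ≤ q, X.map (homOfLE hs) ≫ f = X.map (homOfLE hs) ≫ g) : f = g := by
  by_cases hq : ∃ s ∈ S, s ≤ q
  · obtain ⟨s, hs, hsq⟩ := hq
    obtain ⟨t, ht⟩ := hS q ⟨s, hs, hsq⟩
    have := hX.isIso t q ht.1.2 ht
    exact (cancel_epi _).1 (h t ht.1.1 ht.1.2)
  · push Not at hq
    exact (hX.isZero q hq).eq_of_src _ _

lemma IsConstructible.epi_of_epi_app (hX : IsConstructible S X) (hS : HasFloors S) (φ : Z ⟶ X)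
    (h : ∀ s ∈ S, Epi (φ.app s)) : Epi φ := by
  have (q : Q) : Epi (φ.app q) := ⟨fun f g hfg => hX.hom_ext hS fun s hs hsq => by
    have := h s hs
    rw [← cancel_epi (φ.app s), ← φ.naturality_assoc, ← φ.naturality_assoc, hfg]⟩
  exact NatTrans.epi_of_epi_app φ

variable [Abelian C] [Finite S]

variable (S) in
/-- The top of a functor `X` at `s`: the quotient of `X.obj s` by the images of the values of `X`
at the elements of `S` strictly below `s`. -/
noncomputable def topPart (s : Q) : (Q ⥤ C) ⥤ C where
  obj X := cokernel (Sigma.desc fun t : {t : S // (t : Q) < s} => X.map (homOfLE t.2.le))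
  map f := cokernel.map _ _ (Limits.Sigma.map fun t => f.app t) (f.app s)
    (Sigma.hom_ext _ _ fun t => by simp)

namespace topPart

variable (S) in
/-- The projection of `X.obj s` onto the top of `X` at `s`. -/
noncomputable def proj (s : Q) : (evaluation Q C).obj s ⟶ topPart S s where
  app _ := cokernel.π _
  naturality _ _ _ := (cokernel.π_desc _ _ _).symm

instance (s : Q) : Epi ((proj S s).app X) :=
  inferInstanceAs (Epi (cokernel.π _))

lemma map_proj {s t : Q} (ht : t ∈ S) (h : t < s) :
    X.map (homOfLE h.le) ≫ (proj S s).app X = 0 := by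
  have hcond := Sigma.ι (fun t : {t : S // (t : Q) < s} => X.obj t) ⟨⟨t, ht⟩, h⟩ ≫=
    cokernel.condition (Sigma.desc fun t : {t : S // (t : Q) < s} => X.map (homOfLE t.2.le))
  rwa [Sigma.ι_desc_assoc, comp_zero] at hcond

/-- The morphism out of a top induced by one that kills the values at smaller elements of `S`. -/
noncomputable def desc {s : Q} {A : C} (f : X.obj s ⟶ A)
    (hf : ∀ t ∈ S, ∀ h : t < s, X.map (homOfLE h.le) ≫ f = 0) : (topPart S s).obj X ⟶ A :=
  cokernel.desc _ f (Sigma.hom_ext _ _ fun t => by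
    rw [Sigma.ι_desc_assoc, comp_zero, hf t t.1.2 t.2])

lemma proj_desc {s : Q} {A : C} (f : X.obj s ⟶ A)
    (hf : ∀ t ∈ S, ∀ h : t < s, X.map (homOfLE h.le) ≫ f = 0) :
    (proj S s).app X ≫ desc f hf = f :=
  cokernel.π_desc _ _ _

end topPart

-- Nakayama's lemma; the induction works because `S` is finite.
lemma IsConstructible.epi_of_epi_topPart_map (hX : IsConstructible S X) (hS : HasFloors S)
    (φ : Z ⟶ X) (h : ∀ s ∈ S, Epi ((topPart S s).map φ)) : Epi φ := by
  suffices H : ∀ s : S, Epi (φ.app s) from hX.epi_of_epi_app hS φ fun s hs => H ⟨s, hs⟩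
  intro s
  induction s using WellFoundedLT.induction with
  | ind s ih =>
    refine Preadditive.epi_of_cancel_zero _ fun f hf => ?_
    have hf' (t) (ht : t ∈ S) (hts : t < s) : X.map (homOfLE hts.le) ≫ f = 0 := by
      have : Epi (φ.app t) := ih ⟨t, ht⟩ hts
      rw [← cancel_epi (φ.app t), ← φ.naturality_assoc, hf, comp_zero, comp_zero]
    have hdesc : (topPart S s).map φ ≫ topPart.desc f hf' = 0 := by
      rw [← cancel_epi ((topPart.proj S s).app Z), ← (topPart.proj S s).naturality_assoc,
        topPart.proj_desc, comp_zero]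
      exact hf
    have := h s s.2
    rw [← topPart.proj_desc f hf', zero_of_epi_comp _ hdesc, comp_zero]

lemma IsConstructible.isIso_of_isIso_topPart_map {P : Q ⥤ C} [Projective P]
    (hP : IsConstructible S P) (hS : HasFloors S) (φ : P ⟶ P)
    (h : ∀ s ∈ S, IsIso ((topPart S s).map φ)) : IsIso φ := by
  have : Epi φ := hP.epi_of_epi_topPart_map hS φ fun s hs => have := h s hs; inferInstance
  let ψ : P ⟶ P := Projective.factorThru (𝟙 P) φ
  have hψ : ψ ≫ φ = 𝟙 P := Projective.factorThru_comp _ _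
  have : Epi ψ := hP.epi_of_epi_topPart_map hS ψ fun s hs => by
    have := h s hs
    have hmap : (topPart S s).map ψ ≫ (topPart S s).map φ = 𝟙 _ := by
      rw [← Functor.map_comp, hψ, CategoryTheory.Functor.map_id]
    have : IsIso ((topPart S s).map ψ ≫ (topPart S s).map φ) := hmap ▸ inferInstance
    have := IsIso.of_isIso_comp_right ((topPart S s).map ψ) ((topPart S s).map φ)
    infer_instance
  have : IsSplitMono ψ := ⟨⟨φ, hψ⟩⟩
  have : IsIso ψ := isIso_of_mono_of_epi ψ
  have : IsIso (ψ ≫ φ) := hψ ▸ inferInstance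
  exact IsIso.of_isIso_comp_left ψ φ

end TopPart

section MinimalCover

lemma IsMinimalMorphism.of_isIso_comp {C : Type w} [Category.{v} C] {X Y Z : C} (a : X ⟶ Y)
    [IsIso a] {g : Y ⟶ Z} (h : IsMinimalMorphism (a ≫ g)) : IsMinimalMorphism g := fun φ hφ => by
  have : IsIso (a ≫ φ ≫ inv a) := h _ (by simp [hφ])
  have : IsIso (φ ≫ inv a) := IsIso.of_isIso_comp_left a _
  exact IsIso.of_isIso_comp_right φ (inv a)

variable {Q : Type u} [PartialOrder Q] {C : Type w} [Category.{v} C] [Abelian C] {S : Set Q}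
  {X : Q ⥤ C}

lemma IsConstructible.exists_projective_epi [Finite S] [EnoughProjectives C]
    (hX : IsConstructible S X) (hS : HasFloors S) :
    ∃ (A : S → C) (f : free (Subtype.val : S → Q) A ⟶ X), (∀ s, Projective (A s)) ∧ Epi f := by
  let π (s : S) : Projective.over (X.obj s) ⟶ X.obj s := Projective.π (X.obj s)
  refine ⟨_, free.desc π, fun s => inferInstance, hX.epi_of_epi_app hS _ fun s hs => ?_⟩
  exact epi_of_epi_fac (free.incl_desc_app_self π ⟨s, hs⟩)

variable [Finite S]

lemma free.isIso_incl_proj (A : S → C) (s : S) :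
    IsIso (free.incl Subtype.val A s le_rfl ≫
      (topPart.proj S s).app (free Subtype.val A)) := by
  classical
  let g : (free Subtype.val A).obj (s : Q) ⟶ A s :=
    free.objDesc fun i _ => if h : i = s then eqToHom (congrArg A h) else 0
  have hself : free.incl Subtype.val A s le_rfl ≫ g = 𝟙 _ := by simp [g, free.incl_objDesc]
  have hne (i : S) (hi : (i : Q) ≤ s) (h : i ≠ s) : free.incl Subtype.val A i hi ≫ g = 0 := by
    simp [g, free.incl_objDesc, h]
  refine ⟨topPart.desc g fun t _ h => free.obj_hom_ext fun i hi => ?_, ?_, ?_⟩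
  · rw [reassoc_of% free.incl_map, hne i _ fun his => (his ▸ hi).not_gt h, comp_zero]
  · rw [Category.assoc, topPart.proj_desc, hself]
  · rw [← cancel_epi ((topPart.proj S s).app _), reassoc_of% topPart.proj_desc]
    refine free.obj_hom_ext fun i hi => ?_
    obtain rfl | h := eq_or_ne i s
    · rw [reassoc_of% hself, Category.comp_id]
    · have hlt : (i : Q) < s := lt_of_le_of_ne hi fun h' => h (Subtype.ext h')
      rw [reassoc_of% hne i hi h, ← free.incl_map i le_rfl (homOfLE hlt.le), Category.assoc,
        Category.comp_id, topPart.map_proj i.2 hlt, zero_comp, comp_zero]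

lemma free.exists_comp_topPart_map {A : S → C} [∀ s, Projective (A s)]
    (p : ∀ s : S, A s ⟶ (topPart S s).obj X) :
    ∃ f : free Subtype.val A ⟶ X, ∀ s,
      (free.incl Subtype.val A s le_rfl ≫ (topPart.proj S s).app (free Subtype.val A)) ≫
        (topPart S s).map f = p s := by
  let l (s : S) : A s ⟶ X.obj s := Projective.factorThru (p s) ((topPart.proj S s).app X)
  refine ⟨free.desc l, fun s => ?_⟩
  rw [Category.assoc, ← (topPart.proj S s).naturality]
  exact (reassoc_of% free.incl_desc_app_self l s) _ |>.trans (Projective.factorThru_comp _ _)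

lemma IsConstructible.exists_minimal_cover (hX : IsConstructible S X) (hS : HasFloors S)
    (hC : MinimalCoverAxiom C) :
    ∃ (A : S → C) (f : free (Subtype.val : S → Q) A ⟶ X),
      (∀ s, Projective (A s)) ∧ Epi f ∧ IsMinimalMorphism f := by
  choose A p hA hp hmin using fun s : S => hC ((topPart S s).obj X)
  obtain ⟨f, hf⟩ := free.exists_comp_topPart_map p
  have ha := free.isIso_incl_proj A
  have : Projective (free Subtype.val A) := free.projective
  refine ⟨A, f, hA, hX.epi_of_epi_topPart_map hS f fun s hs => epi_of_epi_fac (hf ⟨s, hs⟩),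
    fun φ hφ => (free.isConstructible Subtype.prop).isIso_of_isIso_topPart_map hS φ fun s hs => ?_⟩
  have hmin_top : IsMinimalMorphism ((topPart S s).map f) :=
    .of_isIso_comp _ (hf ⟨s, hs⟩ ▸ hmin ⟨s, hs⟩)
  exact hmin_top _ (by rw [← Functor.map_comp, hφ])

end MinimalCover

section Tame

variable {Q : Type u} [PartialOrder Q] {C : Type w} [Category.{v} C] [HasFiniteCoproducts C]
  {I : Type*} [Finite I]

lemma free.isDiscretizedBy {D : Type*} [PartialOrder D] (α : D →o Q) (t : I → D) (A : I → C) :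
    IsDiscretizedBy (free (α ∘ t) A) α := by
  let η : free t A ⟶ α.monotone.functor ⋙ free (α ∘ t) A :=
    free.desc fun i => free.incl (α ∘ t) A i le_rfl
  have hη (i) : free.incl t A i le_rfl ≫ η.app (t i) = free.incl (α ∘ t) A i le_rfl :=
    free.incl_desc_app_self _ i
  refine ⟨_, η, ⟨⟨IsInitial.ofUniqueHom (fun E => StructuredArrow.homMk
    (free.desc fun i => free.incl t A i le_rfl ≫ E.hom.app (t i)) ?_) fun E m => ?_⟩⟩⟩
  · refine free.hom_ext fun i => Eq.trans ((reassoc_of% hη i) _) ?_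
    let φ (i) : A i ⟶ E.right.obj (α (t i)) := free.incl t A i le_rfl ≫ E.hom.app (t i)
    exact free.incl_desc_app_self (t := α ∘ t) φ i
  · refine StructuredArrow.hom_ext _ _ (free.hom_ext fun i => ?_)
    refine Eq.trans ?_ (free.incl_desc_app_self (t := α ∘ t) _ i).symm
    rw [← StructuredArrow.w m]
    exact ((reassoc_of% hη i) _).symm

lemma free.isTame (t : I → Q) (A : I → C) : isTame Q C (free t A) :=
  ⟨Set.range t, inferInstance, OrderHom.Subtype.val (· ∈ Set.range t), inferInstance,
    free.isDiscretizedBy (OrderHom.Subtype.val (· ∈ Set.range t)) (Set.rangeFactorization t) A⟩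

/-- Free functors on finite families, as objects of the category of tame functors. -/
noncomputable abbrev tameFree (t : I → Q) (A : I → C) : Tame Q C :=
  ⟨free t A, free.isTame t A⟩

end Tame

section TameProjectives

variable {Q : Type u} [PartialOrder Q] {C : Type w} [Category.{v} C] [Abelian C]
  [(isTame Q C).ContainsZero] [(isTame Q C).IsClosedUnderCokernels]

lemma projective_of_projective_obj (P : Tame Q C) [Projective P.obj] : Projective P where
  factors {E X} f e he := by
    have := (isTame Q C).preservesEpimorphisms_ι_of_isNormalMonoCategory
    have : Epi e.hom := inferInstanceAs (Epi ((isTame Q C).ι.map e))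
    exact ⟨(isTame Q C).homMk (Projective.factorThru f.hom e.hom),
      ObjectProperty.hom_ext _ (Projective.factorThru_comp f.hom e.hom)⟩

lemma tameFree.projective {I : Type*} [Finite I] (t : I → Q) (A : I → C)
    [∀ i, Projective (A i)] : Projective (tameFree t A) :=
  have : Projective (tameFree t A).obj := free.projective
  projective_of_projective_obj _

lemma enoughProjectives_tame (hQ : TameDiscretizableByTransfers Q C) [EnoughProjectives C] :
    EnoughProjectives (Tame Q C) where
  presentation X := by
    obtain ⟨S, hfin, hS, hX⟩ := exists_isConstructible hQ X.property
    have := hfin.to_subtype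
    obtain ⟨A, f, hA, hf⟩ := hX.exists_projective_epi hS
    exact ⟨{
      p := tameFree Subtype.val A
      projective := tameFree.projective _ _
      f := (isTame Q C).homMk f
      epi := (isTame Q C).ι.epi_of_epi_map hf }⟩

lemma minimalCoverAxiom_tame (hQ : TameDiscretizableByTransfers Q C) (hC : MinimalCoverAxiom C) :
    MinimalCoverAxiom (Tame Q C) := fun X => by
  obtain ⟨S, hfin, hS, hX⟩ := exists_isConstructible hQ X.property
  have := hfin.to_subtype
  obtain ⟨A, f, hA, hf, hmin⟩ := hX.exists_minimal_cover hS hC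
  refine ⟨tameFree Subtype.val A, (isTame Q C).homMk f, tameFree.projective _ _,
    (isTame Q C).ι.epi_of_epi_map hf, fun φ hφ => ?_⟩
  have : IsIso ((isTame Q C).ι.map φ) := hmin φ.hom (congrArg (·.hom) hφ)
  exact isIso_of_reflects_iso φ (isTame Q C).ι

end TameProjectives

section ProjectiveDimension

variable {C : Type w} [Category.{v} C] [Abelian C]

lemma exact_epi_comp_iff {X' X Y Z : C} (p : X' ⟶ X) [Epi p] (f : X ⟶ Y) (g : Y ⟶ Z)
    (w : f ≫ g = 0) :
    (ShortComplex.mk (p ≫ f) g (by rw [Category.assoc, w, comp_zero])).Exact ↔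
      (ShortComplex.mk f g w).Exact :=
  ShortComplex.exact_iff_of_epi_of_isIso_of_mono { τ₁ := p, τ₂ := 𝟙 _, τ₃ := 𝟙 _ }

lemma exact_comp_mono_iff {X Y Z Z' : C} (f : X ⟶ Y) (g : Y ⟶ Z) (i : Z ⟶ Z') [Mono i]
    (w : f ≫ g = 0) :
    (ShortComplex.mk f (g ≫ i) (by rw [reassoc_of% w, zero_comp])).Exact ↔
      (ShortComplex.mk f g w).Exact :=
  (ShortComplex.exact_iff_of_epi_of_isIso_of_mono
    (S₁ := .mk f g w) (S₂ := .mk f (g ≫ i) _) { τ₁ := 𝟙 _, τ₂ := 𝟙 _, τ₃ := i }).symm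

lemma shortExact_cokernelDesc {S : ShortComplex C} (hS : S.Exact) :
    (ShortComplex.mk (cokernel.desc S.f S.g S.zero) (cokernel.π S.g)
      (by rw [← cancel_epi (cokernel.π S.f)]; simp)).ShortExact where
  exact := (exact_epi_comp_iff (cokernel.π S.f) _ _ _).1 <| by
    simpa only [cokernel.π_desc] using ShortComplex.exact_cokernel S.g
  mono_f := hS.mono_cokernelDesc
  epi_g := inferInstanceAs (Epi (cokernel.π _))

lemma resolutionLength_le_iff {X : C} (P : ProjectiveResolution X) (n : ℕ) :
    resolutionLength P ≤ n ↔ ∀ k, n < k → IsZero (P.complex.X k) := by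
  constructor
  · intro h k hk
    have hne : {n : ℕ∞ | ∀ k : ℕ, n < k → IsZero (P.complex.X k)}.Nonempty :=
      ⟨⊤, fun k hk => absurd hk not_top_lt⟩
    exact csInf_mem hne k (h.trans_lt (Nat.cast_lt.2 hk))
  · exact fun h => sInf_le fun k hk => h k (Nat.cast_lt.1 hk)

lemma projDim_le_iff (X : C) [Nonempty (ProjectiveResolution X)] (n : ℕ) :
    projDim X ≤ n ↔
      ∃ P : ProjectiveResolution X, ∀ k, n < k → IsZero (P.complex.X k) := by
  simp_rw [← resolutionLength_le_iff]
  constructor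
  · intro h
    obtain ⟨P, hP⟩ : ∃ P : ProjectiveResolution X, resolutionLength P = projDim X :=
      csInf_mem (Set.range_nonempty _)
    exact ⟨P, hP.trans_le h⟩
  · exact fun ⟨P, hP⟩ => iInf_le_of_le P hP

lemma hasProjectiveDimensionLT_cokernel_d {X : C} (P : ProjectiveResolution X) (m k : ℕ)
    (hP : ∀ j, m + k < j → IsZero (P.complex.X j)) :
    HasProjectiveDimensionLT (cokernel (P.complex.d (k + 1) k)) (m + 1) := by
  induction m generalizing k with
  | zero =>
    have hd : P.complex.d (k + 1) k = 0 := (hP _ (by omega)).eq_of_src _ _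
    have : Projective (cokernel (P.complex.d (k + 1) k)) :=
      Projective.of_iso ((cokernelZeroIsoTarget).symm ≪≫ cokernelIsoOfEq hd.symm) (P.projective k)
    infer_instance
  | succ m ih =>
    exact (shortExact_cokernelDesc (P.exact_succ k)).hasProjectiveDimensionLT_X₃ _
      (ih (k + 1) fun j hj => hP j (by omega)) (have := P.projective k; inferInstance)

lemma hasProjectiveDimensionLT_of_resolution {X : C} (P : ProjectiveResolution X) (n : ℕ)
    (hP : ∀ k, n < k → IsZero (P.complex.X k)) : HasProjectiveDimensionLT X (n + 1) := by
  have := hasProjectiveDimensionLT_cokernel_d P n 0 fun k hk => hP k (by omega)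
  let e : cokernel (P.complex.d 1 0) ≅ X :=
    (cokernelIsCokernel _).coconePointUniqueUpToIso P.isColimitCokernelCofork
  exact hasProjectiveDimensionLT_of_iso e _

/-- An exact complex of projective objects ending in an epimorphism to `X`, as a projective
resolution of `X`. -/
noncomputable def projectiveResolutionOfExact (K : ChainComplex C ℕ) (hK : ∀ n, Projective (K.X n))
    {X : C} (f : K.X 0 ⟶ X) (w : K.d 1 0 ≫ f = 0) (hf : Epi f)
    (h₀ : (ShortComplex.mk (K.d 1 0) f w).Exact)
    (h : ∀ n, (ShortComplex.mk _ _ (K.d_comp_d (n + 2) (n + 1) n)).Exact) :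
    ProjectiveResolution X where
  complex := K
  projective := hK
  π := (ChainComplex.toSingle₀Equiv _ _).symm ⟨f, w⟩
  quasiIso := ⟨fun n => by
    cases n with
    | zero =>
      rw [ChainComplex.quasiIsoAt₀_iff, ShortComplex.quasiIso_iff_of_zeros' _
        (K.shape _ _ (by simp)) rfl rfl]
      refine (ShortComplex.exact_and_epi_g_iff_of_iso ?_).2 ⟨h₀, hf⟩
      exact ShortComplex.isoMk (Iso.refl _) (Iso.refl _) (Iso.refl _)
        ((Category.id_comp _).trans (Category.comp_id _).symm) (by
          refine (Category.id_comp _).trans (Eq.trans ?_ (Category.comp_id _).symm)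
          exact (ChainComplex.toSingle₀Equiv_symm_apply_f_zero f w).symm)
    | succ n =>
      rw [quasiIsoAt_iff_exactAt' (hL := ChainComplex.exactAt_succ_single_obj ..),
        HomologicalComplex.exactAt_iff' _ _ _ _ (ChainComplex.prev _ _)
          (ChainComplex.next_nat_succ _)]
      exact h n⟩

lemma exists_resolution_of_shortExact {S : ShortComplex C} (hS : S.ShortExact)
    (h₂ : Projective S.X₂) (R : ProjectiveResolution S.X₁) :
    ∃ R' : ProjectiveResolution S.X₃, ∀ k, R'.complex.X (k + 1) = R.complex.X k := by
  have := hS.mono_f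
  let p : R.complex.X 0 ⟶ S.X₁ := R.π.f 0
  have : Epi p := inferInstanceAs (Epi (R.π.f 0))
  have hp : R.complex.d 1 0 ≫ p = 0 := R.complex_d_comp_π_f_zero
  have w : R.complex.d 1 0 ≫ p ≫ S.f = 0 := by rw [reassoc_of% hp, zero_comp]
  have w' : (p ≫ S.f) ≫ S.g = 0 := by rw [Category.assoc, S.zero, comp_zero]
  refine ⟨projectiveResolutionOfExact (R.complex.augment (p ≫ S.f) w) ?_ S.g w' hS.epi_g
    ((exact_epi_comp_iff p S.f S.g S.zero).2 hS.exact) ?_, fun k => rfl⟩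
  · rintro (_ | n)
    exacts [h₂, R.projective n]
  · rintro (_ | n)
    exacts [(exact_comp_mono_iff _ p S.f hp).2 R.exact₀, R.exact_succ n]

lemma exists_resolution_of_hasProjectiveDimensionLT [EnoughProjectives C] (n : ℕ) (X : C)
    [HasProjectiveDimensionLT X (n + 1)] :
    ∃ P : ProjectiveResolution X, ∀ k, n < k → IsZero (P.complex.X k) := by
  induction n generalizing X with
  | zero =>
    have : Projective X := projective_iff_hasProjectiveDimensionLT_one.2 ‹_›
    exact ⟨ProjectiveResolution.self X, fun k hk =>
      HomologicalComplex.isZero_single_obj_X _ _ _ _ hk.ne'⟩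
  | succ n ih =>
    have hS := shortExact_kernel_projectiveπ X
    have hP : Projective (Projective.over X) := inferInstance
    have := (hS.hasProjectiveDimensionLT_X₃_iff n hP).1 ‹_›
    obtain ⟨R, hR⟩ := ih (kernel (Projective.π X))
    obtain ⟨R', hR'⟩ := exists_resolution_of_shortExact hS hP R
    refine ⟨R', fun k hk => ?_⟩
    obtain ⟨k, rfl⟩ := Nat.exists_eq_succ_of_ne_zero (Nat.ne_zero_of_lt hk)
    exact (hR' k).symm ▸ hR k (Nat.lt_of_succ_lt_succ hk)

lemma projDim_le_iff_hasProjectiveDimensionLT [EnoughProjectives C] (X : C) (n : ℕ) :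
    projDim X ≤ n ↔ HasProjectiveDimensionLT X (n + 1) := by
  have : Nonempty (ProjectiveResolution X) := ⟨ProjectiveResolution.of X⟩
  rw [projDim_le_iff]
  exact ⟨fun ⟨P, hP⟩ => hasProjectiveDimensionLT_of_resolution P n hP,
    fun _ => exists_resolution_of_hasProjectiveDimensionLT n X⟩

lemma catProjDim_le_iff [EnoughProjectives C] (n : ℕ) :
    catProjDim C ≤ n ↔ ∀ X : C, HasProjectiveDimensionLT X (n + 1) := by
  simp only [catProjDim, iSup_le_iff, projDim_le_iff_hasProjectiveDimensionLT]

end ProjectiveDimension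

section Edges

variable {Q : Type u} [PartialOrder Q] {C : Type w} [Category.{v} C] [Abelian C]

/-- The covering pairs of elements of `S`. -/
abbrev Edge (S : Set Q) : Type u := {e : S × S // e.1 ⋖ e.2}

namespace Edge

variable {S : Set Q}

/-- The lower element of a covering pair. -/
abbrev src (e : Edge S) : S := e.1.1

/-- The upper element of a covering pair. -/
abbrev tgt (e : Edge S) : S := e.1.2

lemma le (e : Edge S) : (e.src : Q) ≤ e.tgt := e.2.le

end Edge

lemma DimLEOne.eq_of_covBy (hQ : DimLEOne Q) {S : Set Q} {s t t' : S} {q : Q} (h : s ⋖ t)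
    (h' : s ⋖ t') (ht : (t : Q) ≤ q) (ht' : (t' : Q) ≤ q) : t = t' := by
  obtain hle | hle := hQ s t t' q h.le ht h'.le ht'
  · exact LE.le.eq_of_not_lt (show t ≤ t' from hle) (h'.2 h.lt)
  · exact (LE.le.eq_of_not_lt (show t' ≤ t from hle) (h.2 h'.lt)).symm

lemma DimLEOne.tgt_le_src (hQ : DimLEOne Q) {S : Set Q} {e e' : Edge S} (hne : e' ≠ e) {q : Q}
    (he : (e.tgt : Q) ≤ q) (hs : e.src ≤ e'.src) (he' : (e'.tgt : Q) ≤ q) : e.tgt ≤ e'.src := by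
  obtain hsrc | hlt := hs.eq_or_lt
  · have htgt : e.tgt = e'.tgt :=
      hQ.eq_of_covBy e.2 ((congrArg (· ⋖ e'.tgt) hsrc).mpr e'.2) he he'
    exact absurd (Subtype.ext (Prod.ext hsrc htgt)).symm hne
  · obtain h | h := hQ e.src e.tgt e'.src q e.le he hs (e'.le.trans he')
    · exact h
    · exact not_lt_iff_le_imp_ge.1 (e.2.2 hlt) h

variable (S : Set Q) [Finite S] (X : Q ⥤ C)

/-- The free functor on the values of `X` at the elements of `S`. -/
noncomputable abbrev vertexFree : Q ⥤ C := free (Subtype.val : S → Q) fun s => X.obj s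

/-- The free functor on the values of `X` at the lower elements of covering pairs in `S`, placed at
the upper elements. -/
noncomputable abbrev edgeFree : Q ⥤ C :=
  free (fun e : Edge S => (e.tgt : Q)) fun e => X.obj e.src

variable {S}

/-- The generator of `vertexFree S X` at an element of `S`. -/
noncomputable abbrev vertexIncl (s : S) {q : Q} (h : (s : Q) ≤ q) :
    X.obj s ⟶ (vertexFree S X).obj q :=
  free.incl Subtype.val (fun s : S => X.obj s) s h

/-- The generator of `edgeFree S X` at a covering pair. -/
noncomputable abbrev edgeIncl (e : Edge S) {q : Q} (h : (e.tgt : Q) ≤ q) :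
    X.obj e.src ⟶ (edgeFree S X).obj q :=
  free.incl (fun e : Edge S => (e.tgt : Q)) (fun e : Edge S => X.obj e.src) e h

variable (S)

/-- The canonical morphism to `X` from the free functor on its values. -/
noncomputable def vertexFreeDesc : vertexFree S X ⟶ X :=
  free.desc fun s => 𝟙 (X.obj s)

/-- The relations identifying a generator of `vertexFree S X` at the lower element of a covering
pair with its image at the upper element. -/
noncomputable def edgeToVertex : edgeFree S X ⟶ vertexFree S X :=
  free.desc fun e =>
    X.map (homOfLE e.le) ≫ vertexIncl X e.tgt le_rfl - vertexIncl X e.src e.le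

variable {S} {q : Q}

lemma vertexIncl_vertexFreeDesc (s : S) (h : (s : Q) ≤ q) :
    vertexIncl X s h ≫ (vertexFreeDesc S X).app q = X.map (homOfLE h) :=
  (free.incl_desc_app (fun s : S => 𝟙 (X.obj s)) s h).trans (Category.id_comp _)

lemma edgeIncl_edgeToVertex (e : Edge S) (h : (e.tgt : Q) ≤ q) :
    edgeIncl X e h ≫ (edgeToVertex S X).app q =
      X.map (homOfLE e.le) ≫ vertexIncl X e.tgt h - vertexIncl X e.src (e.le.trans h) := by
  refine (free.incl_desc_app _ e h).trans ?_
  rw [Preadditive.sub_comp, Category.assoc, free.incl_map, free.incl_map]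

lemma edgeToVertex_vertexFreeDesc : edgeToVertex S X ≫ vertexFreeDesc S X = 0 := by
  ext q
  refine free.obj_hom_ext fun e h => ?_
  rw [NatTrans.comp_app, reassoc_of% edgeIncl_edgeToVertex, Preadditive.sub_comp, Category.assoc,
    vertexIncl_vertexFreeDesc, vertexIncl_vertexFreeDesc, ← X.map_comp]
  exact (sub_self _).trans comp_zero.symm

open Classical in
/-- The generator at the covering pair `e`, restricted to `X.obj s`; zero unless `e` lies between
`s` and `q`. -/
noncomputable def chainTerm (s : S) (q : Q) (e : Edge S) : X.obj s ⟶ (edgeFree S X).obj q :=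
  if h : s ≤ e.src ∧ (e.tgt : Q) ≤ q then X.map (homOfLE h.1) ≫ edgeIncl X e h.2 else 0

/-- The sum of the generators of `edgeFree S X` over the covering pairs between `s` and the greatest
element `x` of `S` below `q`. If `Q` has dimension at most one, these form a single chain
`s ⋖ s₁ ⋖ ⋯ ⋖ x`, and the relations along it telescope to the difference of the generators at `x`
and at `s`. -/
noncomputable def chainSum (s : S) (q : Q) : X.obj s ⟶ (edgeFree S X).obj q :=
  letI := Fintype.ofFinite (Edge S)
  ∑ e : Edge S, chainTerm X s q e

lemma chainTerm_src_self (e : Edge S) (h : (e.tgt : Q) ≤ q) :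
    chainTerm X e.src q e = edgeIncl X e h := by
  rw [chainTerm, dif_pos ⟨le_rfl, h⟩]
  exact (congrArg (· ≫ edgeIncl X e h) (X.map_id _)).trans (Category.id_comp _)

lemma chainTerm_tgt_self (e : Edge S) : chainTerm X e.tgt q e = 0 :=
  dif_neg fun h => e.2.lt.not_ge h.1

lemma chainTerm_src_of_ne (hQ : DimLEOne Q) {e e' : Edge S} (hne : e' ≠ e)
    (h : (e.tgt : Q) ≤ q) :
    chainTerm X e.src q e' = X.map (homOfLE e.le) ≫ chainTerm X e.tgt q e' := by
  by_cases hsrc : e.src ≤ e'.src ∧ (e'.tgt : Q) ≤ q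
  · have htgt : e.tgt ≤ e'.src := hQ.tgt_le_src hne h hsrc.1 hsrc.2
    rw [chainTerm, chainTerm, dif_pos hsrc, dif_pos ⟨htgt, hsrc.2⟩, ← X.map_comp_assoc]
    rfl
  · rw [chainTerm, chainTerm, dif_neg hsrc,
      dif_neg fun htgt => hsrc ⟨e.2.le.trans htgt.1, htgt.2⟩, comp_zero]

lemma chainSum_src (hQ : DimLEOne Q) (e : Edge S) (h : (e.tgt : Q) ≤ q) :
    chainSum X e.src q = edgeIncl X e h + X.map (homOfLE e.le) ≫ chainSum X e.tgt q := by
  classical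
  let _ := Fintype.ofFinite (Edge S)
  change ∑ e', chainTerm X e.src q e' = _ + _ ≫ ∑ e', chainTerm X e.tgt q e'
  rw [← Finset.add_sum_erase _ _ (Finset.mem_univ e),
    ← Finset.add_sum_erase _ (chainTerm X e.tgt q) (Finset.mem_univ e), chainTerm_src_self X e h,
    chainTerm_tgt_self, zero_add, Preadditive.comp_sum]
  congr 1
  exact Finset.sum_congr rfl fun e' he' => chainTerm_src_of_ne X hQ (Finset.ne_of_mem_erase he') h

lemma chainSum_eq_zero {x : S} (hx : ∀ s : S, (s : Q) ≤ q → s ≤ x) : chainSum X x q = 0 :=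
  Finset.sum_eq_zero fun e _ => dif_neg fun h =>
    (e.2.lt.trans_le (hx e.tgt h.2)).not_ge h.1

lemma chainSum_edgeToVertex (hQ : DimLEOne Q) {x : S} (hq : (x : Q) ≤ q)
    (hx : ∀ s : S, (s : Q) ≤ q → s ≤ x) (s : S) (hs : (s : Q) ≤ x) :
    chainSum X s q ≫ (edgeToVertex S X).app q =
      X.map (homOfLE hs) ≫ vertexIncl X x hq - vertexIncl X s (hs.trans hq) := by
  induction s using WellFoundedGT.induction with
  | ind s ih =>
    obtain rfl | hlt := eq_or_lt_of_le (show s ≤ x from hs)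
    · rw [chainSum_eq_zero X hx, zero_comp, eq_comm, sub_eq_zero]
      exact (congrArg (· ≫ vertexIncl X s hq) (X.map_id _)).trans (Category.id_comp _)
    · obtain ⟨t, hst, htx⟩ := exists_covBy_le_of_lt hlt
      let e : Edge S := ⟨(s, t), hst⟩
      have hsum : chainSum X s q =
          edgeIncl X e (le_trans htx hq) + X.map (homOfLE e.le) ≫ chainSum X t q :=
        chainSum_src X hQ e _
      have hmap : X.map (homOfLE hs) = X.map (homOfLE e.le) ≫ X.map (homOfLE htx) :=
        X.map_comp (homOfLE e.le) (homOfLE htx)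
      rw [hsum, Preadditive.add_comp, edgeIncl_edgeToVertex, Category.assoc, ih t hst.lt htx, hmap,
        Preadditive.comp_sub, Category.assoc]
      abel

variable (S q) in
/-- The retraction of `edgeToVertex S X` at `q`, for a poset of dimension at most one. -/
noncomputable def vertexToEdge : (vertexFree S X).obj q ⟶ (edgeFree S X).obj q :=
  free.objDesc fun s _ => - chainSum X s q

lemma vertexIncl_vertexToEdge (s : S) (h : (s : Q) ≤ q) :
    vertexIncl X s h ≫ vertexToEdge S X q = - chainSum X s q :=
  free.incl_objDesc (fun s _ => - chainSum X s q) s h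

lemma edgeToVertex_vertexToEdge (hQ : DimLEOne Q) :
    (edgeToVertex S X).app q ≫ vertexToEdge S X q = 𝟙 _ := by
  refine free.obj_hom_ext fun e h => ?_
  rw [reassoc_of% edgeIncl_edgeToVertex X e h, Preadditive.sub_comp, Category.assoc,
    vertexIncl_vertexToEdge, vertexIncl_vertexToEdge, chainSum_src X hQ e h, Category.comp_id,
    Preadditive.comp_neg]
  abel

lemma vertexToEdge_edgeToVertex (hQ : DimLEOne Q) {x : S} (hq : (x : Q) ≤ q)
    (hx : ∀ s : S, (s : Q) ≤ q → s ≤ x) [IsIso (X.map (homOfLE hq))] :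
    vertexToEdge S X q ≫ (edgeToVertex S X).app q + (vertexFreeDesc S X).app q ≫
      inv (X.map (homOfLE hq)) ≫ vertexIncl X x hq = 𝟙 _ := by
  refine free.obj_hom_ext fun s h => ?_
  have hs : (s : Q) ≤ x := hx s h
  have hmap : X.map (homOfLE h) = X.map (homOfLE hs) ≫ X.map (homOfLE hq) :=
    X.map_comp (homOfLE hs) (homOfLE hq)
  rw [Preadditive.comp_add, reassoc_of% vertexIncl_vertexToEdge X s h, Preadditive.neg_comp,
    chainSum_edgeToVertex X hQ hq hx s hs, reassoc_of% vertexIncl_vertexFreeDesc X s h, hmap,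
    Category.assoc, IsIso.hom_inv_id_assoc, Category.comp_id]
  abel

variable (S) in
/-- The presentation of a functor by the generators at the elements of `S` and the relations at the
covering pairs. -/
noncomputable abbrev edgeVertexComplex : ShortComplex (Q ⥤ C) :=
  .mk (edgeToVertex S X) (vertexFreeDesc S X) (edgeToVertex_vertexFreeDesc X)

variable {X}

theorem IsConstructible.shortExact_edgeVertexComplex (hX : IsConstructible S X)
    (hS : HasFloors S) (hQ : DimLEOne Q) : (edgeVertexComplex S X).ShortExact := by
  refine shortExact_of_evaluation fun q => ?_
  obtain ⟨x, hx⟩ | hq := hS.exists_le_iff q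
  · have hq : (x : Q) ≤ q := (hx x).2 le_rfl
    have : IsIso (X.map (homOfLE hq)) :=
      hX.isIso x q hq ⟨⟨x.2, hq⟩, fun s hs => (hx ⟨s, hs.1⟩).1 hs.2⟩
    let σ : X.obj q ⟶ (vertexFree S X).obj q := inv (X.map (homOfLE hq)) ≫ vertexIncl X x hq
    have hg : σ ≫ (vertexFreeDesc S X).app q = 𝟙 (X.obj q) := by
      rw [Category.assoc, vertexIncl_vertexFreeDesc, IsIso.inv_hom_id]
    have hid : vertexToEdge S X q ≫ (edgeToVertex S X).app q + (vertexFreeDesc S X).app q ≫ σ =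
        𝟙 _ := vertexToEdge_edgeToVertex X hQ hq fun s => (hx s).1
    exact ShortComplex.Splitting.shortExact
      { r := vertexToEdge S X q, s := σ
        f_r := edgeToVertex_vertexToEdge X hQ
        s_g := hg
        id := hid }
  · have hedge : IsZero ((edgeFree S X).obj q) := free.isZero_obj fun e => hq e.tgt
    have hvertex : IsZero ((vertexFree S X).obj q) := free.isZero_obj hq
    exact ShortComplex.Splitting.shortExact
      { r := 0, s := 0
        f_r := hedge.eq_of_src _ _
        s_g := (hX.isZero q fun s hs => hq ⟨s, hs⟩).eq_of_src _ _
        id := hvertex.eq_of_src _ _ }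

end Edges

section TameProjectiveDimension

variable {Q : Type u} [PartialOrder Q] {C : Type w} [Category.{v} C] [Abelian C]
  [(isTame Q C).ContainsZero] [(isTame Q C).IsClosedUnderKernels]
  [(isTame Q C).IsClosedUnderCokernels] [(isTame Q C).IsClosedUnderFiniteProducts]

lemma shortExact_of_map_ι {S : ShortComplex (Tame Q C)}
    (hS : (S.map (isTame Q C).ι).ShortExact) : S.ShortExact :=
  have : (isTame Q C).ι.PreservesHomology :=
    { preservesKernels := fun _ _ f => (isTame Q C).preservesKernels_ι f
      preservesCokernels := fun _ _ f => (isTame Q C).preservesCokernels_ι f }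
  ShortExact.reflects_shortExact_of_faithful (isTame Q C).ι hS

variable [EnoughProjectives C]

lemma tameFree.hasProjectiveDimensionLT {I : Type*} [Finite I] (t : I → Q) (n : ℕ) (A : I → C)
    (hA : ∀ i, HasProjectiveDimensionLT (A i) (n + 1)) :
    HasProjectiveDimensionLT (tameFree t A) (n + 1) := by
  induction n generalizing A with
  | zero =>
    have (i : I) : Projective (A i) := projective_iff_hasProjectiveDimensionLT_one.2 (hA i)
    exact projective_iff_hasProjectiveDimensionLT_one.1 (tameFree.projective t A)
  | succ n ih =>
    have hS (i : I) := shortExact_kernel_projectiveπ (A i)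
    have hker := ih (fun i => kernel (Projective.π (A i))) fun i =>
      ((hS i).hasProjectiveDimensionLT_X₃_iff n (Projective.projective_over _)).1 (hA i)
    let T : ShortComplex (Tame Q C) :=
      .mk (X₁ := tameFree t _) (X₂ := tameFree t _) (X₃ := tameFree t A)
        ((isTame Q C).homMk (free.map fun i => kernel.ι (Projective.π (A i))))
        ((isTame Q C).homMk (free.map fun i => Projective.π (A i)))
        (ObjectProperty.hom_ext _ (free.shortComplex t fun i =>
          .mk (kernel.ι (Projective.π (A i))) _ (kernel.condition _)).zero)
    have hT : T.ShortExact := shortExact_of_map_ι (free.shortExact t hS)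
    exact (hT.hasProjectiveDimensionLT_X₃_iff n (tameFree.projective t _)).2 hker

lemma hasProjectiveDimensionLT_tame (hQ : TameDiscretizableByTransfers Q C) (hdim : DimLEOne Q)
    {n : ℕ} (hC : ∀ A : C, HasProjectiveDimensionLT A (n + 1)) (X : Tame Q C) :
    HasProjectiveDimensionLT X (n + 1 + 1) := by
  obtain ⟨S, hfin, hS, hX⟩ := exists_isConstructible hQ X.property
  have := hfin.to_subtype
  let T : ShortComplex (Tame Q C) :=
    .mk (X₁ := tameFree (fun e : Edge S => (e.tgt : Q)) fun e => X.obj.obj e.src)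
      (X₂ := tameFree (Subtype.val : S → Q) fun s => X.obj.obj s)
      ((isTame Q C).homMk (edgeToVertex S X.obj)) ((isTame Q C).homMk (vertexFreeDesc S X.obj))
      (ObjectProperty.hom_ext _ (edgeToVertex_vertexFreeDesc X.obj))
  have hT : T.ShortExact := shortExact_of_map_ι (hX.shortExact_edgeVertexComplex hS hdim)
  have hedge : HasProjectiveDimensionLT T.X₁ (n + 1) :=
    tameFree.hasProjectiveDimensionLT _ n _ fun _ => hC _
  have hvertex : HasProjectiveDimensionLT T.X₂ (n + 1) :=
    tameFree.hasProjectiveDimensionLT _ n _ fun _ => hC _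
  exact hT.hasProjectiveDimensionLT_X₃ (n + 1) hedge
    (hasProjectiveDimensionLT_of_ge _ (n + 1) _ (n + 1).le_succ)

lemma catProjDim_tame_le (hQ : TameDiscretizableByTransfers Q C) (hdim : DimLEOne Q) :
    catProjDim (Tame Q C) ≤ catProjDim C + 1 := by
  have := enoughProjectives_tame hQ
  cases h : catProjDim C with
  | top => simp
  | coe n =>
    exact (catProjDim_le_iff (n + 1)).2
      (hasProjectiveDimensionLT_tame hQ hdim ((catProjDim_le_iff n).1 h.le))

end TameProjectiveDimension

end TameFunctors

theorem mainTheorem3 {Q : Type u} [PartialOrder Q] {C : Type w} [Category.{v} C] [Abelian C]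
    (hQ : TameFunctors.TameDiscretizableByTransfers Q C) :
    ∃ _ : Abelian (TameFunctors.Tame Q C),
      (EnoughProjectives C → EnoughProjectives (TameFunctors.Tame Q C)) ∧
      (TameFunctors.MinimalCoverAxiom C →
        TameFunctors.MinimalCoverAxiom (TameFunctors.Tame Q C)) ∧
      (EnoughProjectives C → TameFunctors.DimLEOne Q →
        TameFunctors.catProjDim (TameFunctors.Tame Q C) ≤ TameFunctors.catProjDim C + 1) := by
  have := TameFunctors.containsZero_isTame Q C
  have := TameFunctors.isClosedUnderKernels_isTame hQ
  have := TameFunctors.isClosedUnderCokernels_isTame hQ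
  have := TameFunctors.isClosedUnderFiniteProducts_isTame hQ
  exact ⟨inferInstance, fun _ => TameFunctors.enoughProjectives_tame hQ,
    TameFunctors.minimalCoverAxiom_tame hQ, fun _ hdim => TameFunctors.catProjDim_tame_le hQ hdim⟩
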